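/- There is an absolute constant $C>0$ such that the following holds for all integers $m\ge 1$, $n\ge 0$, $t\ge 0$. Let $\mathcal H_n$ be the Haar distribution on $n$-qubit pure states (the normalized surface measure on the unit sphere of $\mathbb C^{2^n}$). Let $\mathsf P=(\mathsf P_1,\dots,\mathsf P_m)$, where each register $\mathsf P_i$ consists of $t$ blocks of $n$ qubits, and let \[ \rho_{\mathsf P}:=\mathop{\mathbb E}_{|\psi\rangle\leftarrow\mathcal H_n}\Big[\bigotimes_{i=1}^m |\psi\rangle\langle\psi|^{\otimes t}_{\mathsf P_i}\Big], \qquad \sigma_{\mathsf P}:=\bigotimes_{i=1}^m\ \mathop{\mathbb E}_{|\psi_i\rangle\leftarrow\mathcal H_n}\Big[|\psi_i\rangle\langle\psi_i|^{\otimes t}_{\mathsf P_i}\Big]. \] Then $\rho_{\mathsf P}$ and $\sigma_{\mathsf P}$ are $(m,\,C\,m^2t^2/2^n)$-LOCC indistinguishable: for every $m$-party LOCC adversary $(P_1,\dots,P_m)$ in which $P_i$ receives register $\mathsf P_i$ and $P_m$ outputs a bit, \[ \Big|\Pr\big[(P_1,\dots,P_m)(\rho_{\mathsf P})=1\big]-\Pr\big[(P_1,\dots,P_m)(\sigma_{\mathsf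 P})=1\big]\Big|\le C\,\frac{m^2t^2}{2^n}. \] Here an $m$-party LOCC adversary consists of $m$ computationally unbounded parties without pre-shared entanglement, who for an arbitrary finite number of rounds apply quantum instruments with finitely many outcomes to their own finite-dimensional registers and communicate classically, each operation being allowed to depend on all earlier messages. -/

import Mathlib

open MeasureTheory

namespace HaarLOCC

/-! ### States -/

/-- Labels of the computational basis of an `n`-qubit register: bit strings of length `n`. -/
abbrev Bits (n : ℕ) : Type := Fin n → Bool

/-- The Hilbert space of `n` qubits. -/
abbrev QubitSpace (n : ℕ) : Type := EuclideanSpace ℂ (Bits n)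

/-- The Haar distribution on `n`-qubit pure states: the surface measure on the unit sphere of
`ℂ^(2^n)`, normalized to total mass one. -/
noncomputable def haarState (n : ℕ) : Measure (Metric.sphere (0 : QubitSpace n) 1) :=
  ((volume : Measure (QubitSpace n)).toSphere Set.univ)⁻¹ •
    (volume : Measure (QubitSpace n)).toSphere

instance (n : ℕ) : IsProbabilityMeasure (haarState n) := by
  have h0 : (volume : Measure (QubitSpace n)).toSphere ≠ 0 := by
    rw [Ne, Measure.toSphere_eq_zero_iff_finrank]
    have : 0 < Module.finrank ℝ (QubitSpace n) := Module.finrank_pos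
    omega
  refine ⟨?_⟩
  rw [haarState, Measure.smul_apply, smul_eq_mul]
  exact ENNReal.inv_mul_cancel (by rwa [Ne, Measure.measure_univ_eq_zero]) (measure_ne_top _ _)

/-- The rank-one matrix `|v⟩⟨v|` in the computational basis. -/
noncomputable def ketbra {n : ℕ} (v : QubitSpace n) : Matrix (Bits n) (Bits n) ℂ :=
  Matrix.vecMulVec (fun x => v x) (fun x => star (v x))

/-- The tensor (Kronecker) product of a finite family of matrices. The product basis of the
tensor product of spaces with bases `R i` is indexed by `∀ i, R i`. -/
def tensor {ι : Type} [Fintype ι] {R S : ι → Type} (K : ∀ i, Matrix (S i) (R i) ℂ) :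
    Matrix (∀ i, S i) (∀ i, R i) ℂ :=
  Matrix.of fun a b => ∏ i, K i (a i) (b i)

/-- `|v⟩⟨v|^{⊗ t}`, a matrix on a register of `t` blocks of `n` qubits. -/
noncomputable def copies (t : ℕ) {n : ℕ} (v : QubitSpace n) :
    Matrix (Fin t → Bits n) (Fin t → Bits n) ℂ :=
  tensor fun _ : Fin t => ketbra v

/-- The register of each party: `t` blocks of `n` qubits. -/
abbrev PartyReg (m n t : ℕ) : Fin m → Type := fun _ => Fin t → Bits n

/-- `E_ψ [⨂_{i=1}^m |ψ⟩⟨ψ|^{⊗ t}]`: the parties hold copies of one and the same Haar state.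
The expectation of a random matrix is taken entry by entry. -/
noncomputable def sharedState (m n t : ℕ) :
    Matrix (∀ i, PartyReg m n t i) (∀ i, PartyReg m n t i) ℂ :=
  Matrix.of fun a b => ∫ ψ, (tensor fun _ : Fin m => copies t ψ.1) a b ∂(haarState n)

/-- `E_ψ [|ψ⟩⟨ψ|^{⊗ t}]`: `t` copies of a single Haar state. -/
noncomputable def haarCopies (n t : ℕ) : Matrix (Fin t → Bits n) (Fin t → Bits n) ℂ :=
  Matrix.of fun a b => ∫ ψ, copies t ψ.1 a b ∂(haarState n)

/-- `⨂_{i=1}^m E_{ψ_i} [|ψ_i⟩⟨ψ_i|^{⊗ t}]`: each party holds copies of its own Haar state,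
independent of those of the others. -/
noncomputable def independentState (m n t : ℕ) :
    Matrix (∀ i, PartyReg m n t i) (∀ i, PartyReg m n t i) ℂ :=
  tensor fun _ : Fin m => haarCopies n t

/-! ### LOCC protocols -/

/-- A quantum instrument from a system with basis `R` to a system with basis `S`, with classical
outcomes in `Ω`, in Kraus form. On outcome `w` it maps a state `X` to the subnormalized state
`∑ k, K w k * X * (K w k)ᴴ`, whose trace is the probability of `w`. The index `k` is not
recorded, so an outcome need not be given by a single Kraus operator; `R` and `S` may differ,
so ancillas may be added and subsystems discarded. -/
structure Instrument (R S Ω : Type) [Fintype R] [DecidableEq R] [Fintype S] [Fintype Ω] where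
  /-- the number of Kraus operators per outcome -/
  rank : ℕ
  /-- the Kraus operators -/
  K : Ω → Fin rank → Matrix S R ℂ
  /-- summed over all outcomes, the instrument preserves the trace -/
  complete : ∑ w, ∑ k, (K w k).conjTranspose * K w k = 1

/-- An `m`-party LOCC adversary, run on local registers with bases `R i`.

In a round each party `i` applies an instrument to its own register and announces the
classical outcome `w i` to everybody; what is done afterwards may depend on all outcomes
announced so far. (A party that is idle, or that has nothing to announce, uses an instrument with
one outcome; the unannounced information stays in its register.) After finitely many rounds, the
last party outputs a bit, which is determined by the classical transcript, hence in particular by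
the outcomes of its own measurements. No bound is put on the number of rounds, the length of the
messages, or the size of the registers. -/
inductive Protocol (m : ℕ) : (R : Fin m → Type) → [∀ i, Fintype (R i)] →
    [∀ i, DecidableEq (R i)] → Type 1
  | output {R : Fin m → Type} [∀ i, Fintype (R i)] [∀ i, DecidableEq (R i)] (b : Bool) :
      Protocol m R
  | round {R : Fin m → Type} [∀ i, Fintype (R i)] [∀ i, DecidableEq (R i)]
      (S : Fin m → Type) [∀ i, Fintype (S i)] [∀ i, DecidableEq (S i)]
      (Ω : Fin m → Type) [∀ i, Fintype (Ω i)]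
      (I : ∀ i, Instrument (R i) (S i) (Ω i))
      (next : (∀ i, Ω i) → Protocol m S) : Protocol m R

/-- The joint, subnormalized state after a round in which party `i` applies `I i` and obtains
the outcome `w i`: the image of `ρ` under the tensor product of the local maps. -/
noncomputable def postState {m : ℕ} {R S Ω : Fin m → Type}
    [∀ i, Fintype (R i)] [∀ i, DecidableEq (R i)] [∀ i, Fintype (S i)] [∀ i, Fintype (Ω i)]
    (I : ∀ i, Instrument (R i) (S i) (Ω i)) (w : ∀ i, Ω i)
    (ρ : Matrix (∀ i, R i) (∀ i, R i) ℂ) : Matrix (∀ i, S i) (∀ i, S i) ℂ :=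
  ∑ k : ∀ i, Fin (I i).rank,
    tensor (fun i => (I i).K (w i) (k i)) * ρ *
      (tensor (fun i => (I i).K (w i) (k i))).conjTranspose

/-- The probability that the adversary outputs `1` on the joint input state `ρ`. On a
subnormalized `ρ` this is the joint probability with the event that led to `ρ`. -/
noncomputable def Protocol.prob {m : ℕ} : {R : Fin m → Type} → [∀ i, Fintype (R i)] →
    [∀ i, DecidableEq (R i)] → Protocol m R → Matrix (∀ i, R i) (∀ i, R i) ℂ → ℝ
  | _, _, _, @Protocol.output _ _ _ _ b => fun ρ => if b then ρ.trace.re else 0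
  | _, _, _, @Protocol.round _ _ _ _ _ _ _ Ω _ I next => fun ρ =>
      ∑ w : ∀ i, Ω i, (next w).prob (postState I w ρ)

/-- `(m, ε)`-LOCC indistinguishability of two states on `m` registers. -/
def LOCCIndistinguishable {m : ℕ} {R : Fin m → Type} [∀ i, Fintype (R i)]
    [∀ i, DecidableEq (R i)] (ε : ℝ) (ρ σ : Matrix (∀ i, R i) (∀ i, R i) ℂ) : Prop :=
  ∀ P : Protocol m R, |P.prob ρ - P.prob σ| ≤ ε

end HaarLOCC

/-! ### The Fischer norm and Bombieri's inequality -/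

/-! Write `N = 2 ^ n`. For a product operator `⨂ L i` and a basis label `s`, the amplitude at `s` of
`⨂ L i` applied to copies of `ψ` is a product of polynomials `p i`, homogeneous of degree `t` in the
coordinates of `ψ`. The diagonal entry at `s` is therefore `E |∏ p i| ^ 2` for the shared state and
`∏ E |p i| ^ 2` for the independent one. For `p` homogeneous of degree `d`, `E |p| ^ 2` is the
Fischer norm of `p` divided by `N (N + 1) ⋯ (N + d - 1)`. Bombieri's inequality says that the
Fischer norm of a product is at least the product of the norms, so each shared entry is at least `1
- (m t) ^ 2 / N` times the independent one (`mul_independentState_diag_le`). Every branch of an LOCC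
protocol acts by product Kraus operators, so the bound passes to the probability of output 1 and to
that of output 0 (`Protocol.mul_prob_le`). A one-sided bound on both outputs gives the two-sided
estimate. -/

namespace HaarLOCC

open Finset MvPolynomial

/-- The overlap kernel that diagonalizes the Gram matrix of products of monomials in one
variable. -/
noncomputable def overlap (k l a b : ℕ) : ℝ :=
  if k ≤ a ∧ a + l = b + k then (a.factorial * b.factorial : ℝ) / (a - k).factorial else 0

lemma overlap_of_ne_zero {k l a b : ℕ} (h : overlap k l a b ≠ 0) : k ≤ a ∧ a + l = b + k := by
  unfold overlap at h
  by_contra h'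
  exact h (if_neg h')

lemma overlap_add (k l p : ℕ) :
    overlap k l (k + p) (l + p) = ((k + p).factorial * (l + p).factorial : ℝ) / p.factorial := by
  rw [overlap, if_pos ⟨by omega, by omega⟩, Nat.add_sub_cancel_left]

/-- Vandermonde's identity for `(a + b).choose a'`, in disguise. `overlap k l a b` is the Fischer
inner product of the `k`-th derivative of `X ^ a` with the `l`-th derivative of `X ^ b`. The pairing
is crossed, `a` with `b'` and `a'` with `b`, so that the expansion of a product's norm becomes a sum
of squares. -/
lemma sum_overlap_mul_overlap {M a b a' b' : ℕ} (ha : a < M) (hb : b < M) :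
    ∑ x ∈ range M ×ˢ range M, overlap x.1 x.2 a b' * overlap x.1 x.2 a' b /
      (x.1.factorial * x.2.factorial) =
    if a + b = a' + b' then ((a + b).factorial : ℝ) else 0 := by
  split_ifs with h
  · have hch : ((a + b).factorial : ℝ) =
        a'.factorial * b'.factorial * ((a + b).choose a' : ℕ) := by
      rw [← Nat.choose_mul_factorial_mul_factorial (show a' ≤ a + b by omega),
        show a + b - a' = b' by omega]
      push_cast; ring
    have key : ∀ k p l q : ℕ, a = k + p → b = l + q → a' = k + q → b' = l + p →
        overlap k l a b' * overlap k l a' b / (k.factorial * l.factorial) =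
          (a'.factorial * b'.factorial : ℝ) * ((a.choose k * b.choose q : ℕ) : ℝ) := by
      rintro k p l q rfl rfl rfl rfl
      rw [overlap_add, overlap_add, Nat.cast_mul, Nat.cast_add_choose, add_comm l q,
        Nat.cast_add_choose]
      field_simp
    rw [hch, Nat.add_choose_eq, Nat.cast_sum, mul_sum]
    -- Only nonzero terms are matched. There `l` is determined by `k`, and `k ≤ a`, `l ≤ b`, so the
    -- cutoff `M` loses nothing.
    refine sum_bij_ne_zero (fun x _ _ => (x.1, a' - x.1)) ?_ ?_ ?_ ?_
    · rintro ⟨k, l⟩ _ h0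
      have h1 := overlap_of_ne_zero (left_ne_zero_of_mul (left_ne_zero_of_mul h0))
      have h2 := overlap_of_ne_zero (right_ne_zero_of_mul (left_ne_zero_of_mul h0))
      simp only [HasAntidiagonal.mem_antidiagonal] at *
      omega
    · rintro ⟨k, l⟩ _ h0 ⟨k', l'⟩ _ h0' heq
      have h1 := overlap_of_ne_zero (left_ne_zero_of_mul (left_ne_zero_of_mul h0))
      have h2 := overlap_of_ne_zero (left_ne_zero_of_mul (left_ne_zero_of_mul h0'))
      simp only [Prod.mk.injEq] at *
      omega
    · rintro ⟨k, q⟩ hq h0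
      rw [HasAntidiagonal.mem_antidiagonal] at hq
      have hk : k ≤ a := by
        by_contra hk
        simp [Nat.choose_eq_zero_of_lt (not_le.1 hk)] at h0
      have hqb : q ≤ b := by
        by_contra hk
        simp [Nat.choose_eq_zero_of_lt (not_le.1 hk)] at h0
      simp only at hq
      refine ⟨(k, b - q), by simp only [mem_product, mem_range]; omega, ?_, ?_⟩
      · rw [key k (a - k) (b - q) q (by omega) (by omega) (by omega) (by omega)]
        exact h0
      · simp only [Prod.mk.injEq, true_and]; omega
    · rintro ⟨k, l⟩ _ h0
      have h1 := overlap_of_ne_zero (left_ne_zero_of_mul (left_ne_zero_of_mul h0))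
      have h2 := overlap_of_ne_zero (right_ne_zero_of_mul (left_ne_zero_of_mul h0))
      simp only at h1 h2
      exact key k (a - k) l (a' - k) (by omega) (by omega) (by omega) (by omega)
  · refine sum_eq_zero fun x _ => ?_
    by_contra h0
    have h1 := overlap_of_ne_zero (left_ne_zero_of_mul (left_ne_zero_of_mul h0))
    have h2 := overlap_of_ne_zero (right_ne_zero_of_mul (left_ne_zero_of_mul h0))
    omega

variable {σ : Type*} [Fintype σ]

lemma sum_prod_overlap_mul_overlap [DecidableEq σ] {M : ℕ} {a b a' b' : σ → ℕ}
    (ha : ∀ i, a i < M) (hb : ∀ i, b i < M) :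
    ∑ x ∈ Fintype.piFinset fun _ : σ => range M ×ˢ range M,
      (∏ i, overlap (x i).1 (x i).2 (a i) (b' i)) * (∏ i, overlap (x i).1 (x i).2 (a' i) (b i)) /
        (∏ i, ((x i).1.factorial * (x i).2.factorial : ℝ)) =
    if a + b = a' + b' then ∏ i, ((a i + b i).factorial : ℝ) else 0 := by
  simp_rw [← prod_mul_distrib, ← prod_div_distrib]
  rw [Finset.sum_prod_piFinset (range M ×ˢ range M) (fun i y => overlap y.1 y.2 (a i) (b' i) *
    overlap y.1 y.2 (a' i) (b i) / (y.1.factorial * y.2.factorial))]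
  simp_rw [sum_overlap_mul_overlap (ha _) (hb _)]
  split_ifs with h
  · refine prod_congr rfl fun i _ => if_pos ?_
    simpa using congrFun h i
  · obtain ⟨i, hi⟩ := Function.ne_iff.1 h
    exact prod_eq_zero (mem_univ i) (if_neg hi)

/-- The squared Fischer norm of a polynomial: monomials are orthogonal and the squared norm of
`X ^ α` is `α!`. -/
noncomputable def fischer (P : MvPolynomial σ ℂ) : ℝ :=
  ∑ α ∈ P.support, (∏ i, ((α i).factorial : ℝ)) * ‖P.coeff α‖ ^ 2

lemma fischer_nonneg (P : MvPolynomial σ ℂ) : 0 ≤ fischer P :=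
  sum_nonneg fun _ _ => by positivity

lemma fischer_one : fischer (1 : MvPolynomial σ ℂ) = 1 := by
  classical
  simp [fischer, MvPolynomial.support_one]

lemma fischer_eq_sum {P : MvPolynomial σ ℂ} {T : Finset (σ →₀ ℕ)} (hT : P.support ⊆ T) :
    fischer P = ∑ α ∈ T, (∏ i, ((α i).factorial : ℝ)) * ‖P.coeff α‖ ^ 2 :=
  sum_subset hT fun α _ h => by simp [notMem_support_iff.1 h]

lemma sum_norm_sq_sum_ite {S T : Type*} [DecidableEq T] (s : Finset S) (t : Finset T) (f : S → T)
    (hf : ∀ x ∈ s, f x ∈ t) (c : S → ℂ) (w : T → ℝ) :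
    ((∑ y ∈ t, w y * ‖∑ x ∈ s, if f x = y then c x else 0‖ ^ 2 : ℝ) : ℂ) =
      ∑ x ∈ s, ∑ x' ∈ s, (if f x = f x' then (w (f x) : ℂ) else 0) * (star (c x) * c x') := by
  push_cast
  simp_rw [← Complex.conj_mul', map_sum, sum_mul_sum, mul_sum]
  rw [sum_comm]
  refine sum_congr rfl fun x hx => ?_
  rw [sum_comm]
  refine sum_congr rfl fun x' _ => ?_
  rw [sum_eq_single_of_mem (f x) (hf x hx)]
  · by_cases h : f x = f x'
    · simp [h]
    · simp [h, Ne.symm h]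
  · intro y _ hy
    simp [Ne.symm hy]

lemma coeff_mul_eq_sum {σ : Type*} [DecidableEq σ] (P Q : MvPolynomial σ ℂ) (γ : σ →₀ ℕ) :
    (P * Q).coeff γ = ∑ x ∈ P.support ×ˢ Q.support,
      if x.1 + x.2 = γ then P.coeff x.1 * Q.coeff x.2 else 0 := by
  conv_lhs => rw [P.as_sum, Q.as_sum, sum_mul_sum, ← sum_product', coeff_sum]
  refine sum_congr rfl fun x _ => ?_
  rw [monomial_mul, coeff_monomial]

/-- Exchanging the second entries of the two pairs decouples the sum. In Reznick's expansion the two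
resulting factors are complex conjugates. -/
lemma sum_sum_mul_cross {A B R : Type*} [CommSemiring R] (s : Finset A) (t : Finset B)
    (f g : A → B → R) :
    ∑ y ∈ s ×ˢ t, ∑ y' ∈ s ×ˢ t, f y.1 y'.2 * g y'.1 y.2 =
      (∑ a ∈ s, ∑ b ∈ t, f a b) * ∑ a ∈ s, ∑ b ∈ t, g a b := by
  rw [sum_mul_sum, sum_product]
  simp_rw [sum_product, ← sum_mul, mul_sum]
  exact sum_congr rfl fun a _ => sum_comm

/-- Reznick's expansion of the Fischer norm of a product as a sum of squares. -/
lemma fischer_mul_eq [DecidableEq σ] (P Q : MvPolynomial σ ℂ) {M : ℕ}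
    (hP : ∀ α ∈ P.support, ∀ i, α i < M) (hQ : ∀ α ∈ Q.support, ∀ i, α i < M) :
    fischer (P * Q) = ∑ x ∈ Fintype.piFinset fun _ : σ => range M ×ˢ range M,
      (∏ i, ((x i).1.factorial * (x i).2.factorial : ℝ))⁻¹ *
        ‖∑ α ∈ P.support, ∑ β ∈ Q.support, (∏ i, overlap (x i).1 (x i).2 (α i) (β i) : ℝ) *
          (star (P.coeff α) * Q.coeff β)‖ ^ 2 := by
  have hsub : (P * Q).support ⊆ (P.support ×ˢ Q.support).image fun x => x.1 + x.2 := by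
    intro γ hγ
    rw [mem_support_iff, coeff_mul_eq_sum] at hγ
    obtain ⟨x, hx, h⟩ := exists_ne_zero_of_sum_ne_zero hγ
    exact mem_image.2 ⟨x, hx, by by_contra h'; exact h (if_neg h')⟩
  rw [← Complex.ofReal_inj, fischer_eq_sum hsub]
  simp_rw [coeff_mul_eq_sum P Q]
  rw [sum_norm_sq_sum_ite _ _ (fun x : (σ →₀ ℕ) × (σ →₀ ℕ) => x.1 + x.2)
    (fun x hx => mem_image_of_mem _ hx) (fun x => P.coeff x.1 * Q.coeff x.2)
    (fun γ => ∏ i, ((γ i).factorial : ℝ))]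
  push_cast
  simp_rw [← Complex.conj_mul']
  trans ∑ y ∈ P.support ×ˢ Q.support, ∑ y' ∈ P.support ×ˢ Q.support,
    ∑ x ∈ Fintype.piFinset fun _ : σ => range M ×ˢ range M,
      (((∏ i, overlap (x i).1 (x i).2 (y.1 i) (y'.2 i)) *
        (∏ i, overlap (x i).1 (x i).2 (y'.1 i) (y.2 i)) /
        (∏ i, ((x i).1.factorial * (x i).2.factorial : ℝ)) : ℝ) : ℂ) *
        (star (P.coeff y.1 * Q.coeff y.2) * (P.coeff y'.1 * Q.coeff y'.2))
  · refine sum_congr rfl fun y hy => sum_congr rfl fun y' _ => ?_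
    rw [mem_product] at hy
    rw [← sum_mul, ← Complex.ofReal_sum, sum_prod_overlap_mul_overlap (hP _ hy.1) (hQ _ hy.2)]
    congr 1
    simp only [← Finsupp.coe_add, DFunLike.coe_fn_eq]
    split_ifs <;> simp
  · rw [sum_congr rfl fun y _ => sum_comm, sum_comm]
    refine sum_congr rfl fun x _ => ?_
    rw [mul_comm (starRingEnd ℂ _), map_sum]
    simp_rw [map_sum]
    rw [← sum_sum_mul_cross, mul_sum]
    refine sum_congr rfl fun y _ => ?_
    rw [mul_sum]
    refine sum_congr rfl fun y' _ => ?_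
    simp only [map_mul, Complex.star_def, Complex.conj_conj, Complex.ofReal_div,
      Complex.ofReal_mul, Complex.ofReal_prod, Complex.ofReal_natCast, map_prod,
      Complex.conj_ofReal]
    ring

lemma sum_eq_of_mem_support {R : MvPolynomial σ ℂ} {k : ℕ} (hR : R.IsHomogeneous k)
    {α : σ →₀ ℕ} (hα : α ∈ R.support) : ∑ i, α i = k := by
  have := hR (mem_support_iff.1 hα)
  rw [← Finsupp.degree_eq_sum, Finsupp.degree_eq_weight_one]
  exact this

/-- **Bombieri's inequality.** -/
theorem fischer_mul_fischer_le {P Q : MvPolynomial σ ℂ} {d e : ℕ} (hP : P.IsHomogeneous d)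
    (hQ : Q.IsHomogeneous e) : fischer P * fischer Q ≤ fischer (P * Q) := by
  classical
  have hle := @sum_eq_of_mem_support σ _
  have hlt : ∀ {R : MvPolynomial σ ℂ} {k : ℕ}, R.IsHomogeneous k → ∀ α ∈ R.support, ∀ i, α i ≤ k :=
    fun hR α hα i => (hle hR hα) ▸
      single_le_sum (f := fun i => α i) (fun _ _ => Nat.zero_le _) (mem_univ i)
  rw [fischer_mul_eq P Q (M := d + e + 1) (fun α hα i => by have := hlt hP α hα i; omega)
    (fun α hα i => by have := hlt hQ α hα i; omega), fischer, fischer, sum_mul_sum, ← sum_product']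
  set G : (σ → ℕ × ℕ) → ℝ := fun x => (∏ i, ((x i).1.factorial * (x i).2.factorial : ℝ))⁻¹ *
        ‖∑ α ∈ P.support, ∑ β ∈ Q.support, (∏ i, overlap (x i).1 (x i).2 (α i) (β i) : ℝ) *
          (star (P.coeff α) * Q.coeff β)‖ ^ 2 with hG
  let e : (σ →₀ ℕ) × (σ →₀ ℕ) → σ → ℕ × ℕ := fun z i => (z.1 i, z.2 i)
  have he : Function.Injective e := by
    rintro ⟨a, b⟩ ⟨a', b'⟩ h
    have h' := fun i => Prod.mk.injEq _ _ _ _ ▸ congrFun h i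
    exact Prod.ext (Finsupp.ext fun i => (h' i).1) (Finsupp.ext fun i => (h' i).2)
  -- Of the nonnegative terms in Reznick's expansion, keep those whose index is a pair of exponents
  -- from the two supports. They already add up to the product of the norms.
  calc _ = ∑ z ∈ P.support ×ˢ Q.support, G (e z) := ?_
    _ = ∑ x ∈ (P.support ×ˢ Q.support).image e, G x := (sum_image he.injOn).symm
    _ ≤ _ := sum_le_sum_of_subset_of_nonneg ?_ fun x _ _ => by positivity
  · refine sum_congr rfl fun z hz => ?_
    obtain ⟨κ, l⟩ := z
    rw [mem_product] at hz
    simp only [hG, e]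
    -- A nonzero overlap needs `κ ≤ α` pointwise. Since `α` and `κ` have the same degree, `α = κ`,
    -- and then `β = l`.
    rw [sum_eq_single_of_mem κ hz.1, sum_eq_single_of_mem l hz.2]
    · have h1 : ∏ i, overlap (κ i) (l i) (κ i) (l i) =
          ∏ i, ((κ i).factorial * (l i).factorial : ℝ) :=
        prod_congr rfl fun i _ => by simpa using overlap_add (κ i) (l i) 0
      rw [h1, norm_mul, norm_mul, norm_star, Complex.norm_real, Real.norm_of_nonneg (by positivity),
        prod_mul_distrib]
      have h2 : ∏ i, ((κ i).factorial : ℝ) ≠ 0 := by positivity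
      have h3 : ∏ i, ((l i).factorial : ℝ) ≠ 0 := by positivity
      field_simp
    · intro β _ hne
      obtain ⟨i, hi⟩ := DFunLike.ne_iff.1 hne
      rw [prod_eq_zero (mem_univ i), Complex.ofReal_zero, zero_mul]
      by_contra h0
      have := overlap_of_ne_zero h0
      omega
    · intro α hα hne
      have : ∃ i, α i < κ i := by
        by_contra! hcon
        refine hne (Finsupp.ext fun i => ?_)
        have := (sum_eq_sum_iff_of_le fun i _ => hcon i).1 ((hle hP hz.1).trans (hle hP hα).symm)
        exact (this i (mem_univ i)).symm
      obtain ⟨i, hi⟩ := this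
      refine sum_eq_zero fun β _ => ?_
      rw [prod_eq_zero (mem_univ i), Complex.ofReal_zero, zero_mul]
      by_contra h0
      have := overlap_of_ne_zero h0
      omega
  · intro x hx
    obtain ⟨z, hz, rfl⟩ := mem_image.1 hx
    rw [mem_product] at hz
    refine Fintype.mem_piFinset.2 fun i => ?_
    have h1 := hlt hP _ hz.1 i
    have h2 := hlt hQ _ hz.2 i
    simp only [e, mem_product, mem_range]
    omega

lemma prod_fischer_le {ι : Type*} (s : Finset ι) {P : ι → MvPolynomial σ ℂ} {d : ι → ℕ}
    (hP : ∀ i ∈ s, (P i).IsHomogeneous (d i)) :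
    ∏ i ∈ s, fischer (P i) ≤ fischer (∏ i ∈ s, P i) := by
  classical
  induction s using Finset.induction with
  | empty => simp [fischer_one]
  | insert a s ha ih =>
    rw [prod_insert ha, prod_insert ha]
    have hs : ∀ i ∈ s, (P i).IsHomogeneous (d i) := fun i hi => hP i (mem_insert_of_mem hi)
    exact (mul_le_mul_of_nonneg_left (ih hs) (fischer_nonneg _)).trans
      (fischer_mul_fischer_le (hP a (mem_insert_self a s)) (IsHomogeneous.prod s P d hs))

end HaarLOCC

/-! ### Moments of the Haar distribution -/

namespace HaarLOCC

open Finset MvPolynomial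

/-- One-dimensional Gaussian moment integrand. -/
noncomputable def gaussMonomial (a b : ℕ) (z : ℂ) : ℂ :=
  star z ^ a * z ^ b * (Real.exp (-‖z‖ ^ 2) : ℝ)

lemma integrable_gaussMonomial (a b : ℕ) : Integrable (gaussMonomial a b) := by
  have h : Integrable (fun z : ℂ => ‖z‖ ^ (a + b) * Real.exp (-‖z‖ ^ 2)) := by
    rw [integrable_fun_norm_addHaar (μ := (volume : Measure ℂ))
      (f := fun y : ℝ => y ^ (a + b) * Real.exp (-y ^ 2))]
    have := integrableOn_rpow_mul_exp_neg_mul_sq (b := 1) one_pos (s := (1 + (a + b) : ℕ))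
      (lt_of_lt_of_le (by norm_num) (Nat.cast_nonneg _))
    refine this.congr_fun (fun y _ => ?_) measurableSet_Ioi
    simp only [Real.rpow_natCast, Complex.finrank_real_complex, smul_eq_mul]
    ring_nf
  refine h.mono' (by unfold gaussMonomial; fun_prop) (.of_forall fun z => ?_)
  simp only [gaussMonomial, norm_mul, norm_pow, norm_star, Complex.norm_real, Real.norm_eq_abs,
    Real.abs_exp]
  rw [pow_add]

/-- For `a = b` this is a Gamma integral. For `a ≠ b` a rotation preserves the measure but
multiplies the integrand by a phase, so the integral vanishes. -/
lemma integral_gaussMonomial (a b : ℕ) :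
    ∫ z, gaussMonomial a b z = if a = b then (Real.pi * a.factorial : ℂ) else 0 := by
  split_ifs with h
  · subst h
    have := Complex.integral_rpow_mul_exp_neg_rpow (p := 2) (q := (2 * a : ℕ)) one_le_two
      (by push_cast; linarith [(Nat.cast_nonneg a : (0 : ℝ) ≤ a)])
    have h2 : ((2 * a : ℕ) + 2 : ℝ) / 2 = a + 1 := by push_cast; ring
    rw [h2, Real.Gamma_nat_eq_factorial, mul_div_cancel_left₀ _ (two_ne_zero)] at this
    have h3 := congrArg (fun x : ℝ => (x : ℂ)) this
    rw [← integral_complex_ofReal] at h3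
    push_cast at h3
    rw [← h3]
    refine integral_congr_ae (.of_forall fun z => ?_)
    simp only [gaussMonomial]
    rw [← mul_pow, Complex.star_def, Complex.conj_mul', ← pow_mul]
    push_cast
    congr 2
    all_goals norm_cast
  · obtain ⟨c, hc⟩ : ∃ c : Circle, (star (c : ℂ)) ^ a * (c : ℂ) ^ b ≠ 1 := by
      have hba : (b : ℂ) - a ≠ 0 := sub_ne_zero.2 fun h' => h (Nat.cast_injective h').symm
      -- This angle makes the phase equal to `-1`.
      refine ⟨Circle.exp (Real.pi / (b - a)), ?_⟩
      rw [Circle.coe_exp, Complex.star_def, ← Complex.exp_conj, ← Complex.exp_nat_mul,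
        ← Complex.exp_nat_mul, ← Complex.exp_add, map_mul, Complex.conj_I, Complex.conj_ofReal]
      have : (a : ℂ) * (((Real.pi / (b - a) : ℝ) : ℂ) * -Complex.I) +
          b * (((Real.pi / (b - a) : ℝ) : ℂ) * Complex.I) = Real.pi * Complex.I := by
        push_cast
        field_simp
        ring
      rw [this, Complex.exp_pi_mul_I]
      norm_num
    have h1 : ∫ z, gaussMonomial a b (rotation c z) = ∫ z, gaussMonomial a b z :=
      ((rotation c).measurePreserving).integral_comp (rotation c).toMeasurableEquiv.measurableEmbedding _
    have h2 : ∀ z, gaussMonomial a b (rotation c z) =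
        ((star (c : ℂ)) ^ a * (c : ℂ) ^ b) * gaussMonomial a b z := by
      intro z
      simp only [gaussMonomial, rotation_apply, norm_mul, Circle.norm_coe, one_mul, star_mul']
      ring
    simp_rw [h2] at h1
    rw [integral_const_mul] at h1
    by_contra h0
    exact hc (mul_right_cancel₀ h0 (h1.trans (one_mul _).symm))

/-- In polar coordinates the integral splits into a spherical factor and the radial integral of `r ^
(k + dim - 1) * exp (-r ^ 2)`. This trades sphere moments for Gaussian ones, which factor over the
coordinates. -/
lemma integral_homogeneous_mul_exp {E : Type*} [NormedAddCommGroup E] [NormedSpace ℝ E]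
    [Nontrivial E] [FiniteDimensional ℝ E] [MeasurableSpace E] [BorelSpace E] (μ : Measure E)
    [μ.IsAddHaarMeasure] {f : E → ℝ} {k : ℕ} (hf : ∀ r : ℝ, 0 < r → ∀ x, f (r • x) = r ^ k * f x) :
    ∫ x, f x * Real.exp (-‖x‖ ^ 2) ∂μ =
      (∫ x, f x.1 ∂μ.toSphere) * (Real.Gamma ((k + Module.finrank ℝ E : ℕ) / 2) / 2) := by
  have hr : ∫ r : Set.Ioi (0 : ℝ), r.1 ^ k * Real.exp (-r.1 ^ 2)
      ∂(.volumeIoiPow (Module.finrank ℝ E - 1)) =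
        Real.Gamma ((k + Module.finrank ℝ E : ℕ) / 2) / 2 := by
    have hpos : 0 < Module.finrank ℝ E := Module.finrank_pos
    have hG := integral_rpow_mul_exp_neg_rpow (p := 2) (q := (k + Module.finrank ℝ E - 1 : ℕ))
      two_pos (lt_of_lt_of_le (by norm_num) (Nat.cast_nonneg _))
    rw [← Nat.cast_succ, Nat.succ_eq_add_one, Nat.sub_add_cancel (by omega)] at hG
    rw [div_eq_mul_one_div, mul_comm, ← hG]
    simp only [Measure.volumeIoiPow, ENNReal.ofReal]
    rw [integral_withDensity_eq_integral_smul,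
      integral_subtype_comap measurableSet_Ioi fun a : ℝ ↦
        Real.toNNReal (a ^ (Module.finrank ℝ E - 1)) • (a ^ k * Real.exp (-a ^ 2))]
    · refine setIntegral_congr_fun measurableSet_Ioi fun x (hx : 0 < x) ↦ ?_
      rw [NNReal.smul_def, Real.coe_toNNReal _ (pow_nonneg hx.le _), Real.rpow_natCast,
        Nat.add_sub_assoc hpos, pow_add, smul_eq_mul]
      norm_cast
      ring
    · exact (measurable_subtype_coe.pow_const _).real_toNNReal
  calc
    _ = ∫ x : ({(0)}ᶜ : Set E), f x.1 * Real.exp (-‖x.1‖ ^ 2) ∂(μ.comap (↑)) := by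
      rw [integral_subtype_comap (measurableSet_singleton _).compl
        fun x ↦ f x * Real.exp (-‖x‖ ^ 2), restrict_compl_singleton]
    _ = ∫ x, f x.1.1 * (x.2.1 ^ k * Real.exp (-x.2.1 ^ 2))
          ∂μ.toSphere.prod (.volumeIoiPow (Module.finrank ℝ E - 1)) := by
      rw [← μ.measurePreserving_homeomorphUnitSphereProd.integral_comp
        (Homeomorph.measurableEmbedding _)]
      refine integral_congr_ae (.of_forall fun x => ?_)
      have hx : 0 < ‖x.1‖ := norm_pos_iff.2 x.2
      have h1 := hf ‖x.1‖ hx (‖x.1‖⁻¹ • x.1)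
      rw [smul_inv_smul₀ hx.ne'] at h1
      simp only [homeomorphUnitSphereProd_apply_fst_coe, homeomorphUnitSphereProd_apply_snd_coe]
      rw [h1]
      ring
    _ = _ := by
      rw [integral_prod_mul (fun x : Metric.sphere (0 : E) 1 => f x.1)
        (fun r : Set.Ioi (0 : ℝ) => r.1 ^ k * Real.exp (-r.1 ^ 2)), hr]

/-- Uniqueness of Haar measure. The value of `c` is irrelevant because normalizing the sphere
measure removes it. -/
lemma exists_integral_comp_ofLp (ι : Type*) [Fintype ι] : ∃ c : ℝ, ∀ g : (ι → ℂ) → ℂ,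
    ∫ z : EuclideanSpace ℂ ι, g z.ofLp = c * ∫ z, g z := by
  let e := PiLp.continuousLinearEquiv 2 ℝ (fun _ : ι => ℂ)
  have : (Measure.map e (volume : Measure (EuclideanSpace ℂ ι))).IsAddHaarMeasure :=
    e.isAddHaarMeasure_map _
  refine ⟨(Measure.map e volume).addHaarScalarFactor (volume : Measure (ι → ℂ)), fun g => ?_⟩
  have h1 : ∫ z, g z ∂(Measure.map e volume) = ∫ z : EuclideanSpace ℂ ι, g z.ofLp :=
    e.toHomeomorph.measurableEmbedding.integral_map g
  have h2 := congrArg (fun μ => ∫ z, g z ∂μ)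
    (Measure.isAddLeftInvariant_eq_smul (Measure.map e volume) (volume : Measure (ι → ℂ)))
  rw [← h1, h2, integral_smul_nnreal_measure]
  rfl

lemma integral_prod_gaussMonomial {ι : Type*} [Fintype ι] (α β : ι →₀ ℕ) :
    ∫ z : ι → ℂ, ∏ i, gaussMonomial (α i) (β i) (z i) =
      if α = β then (Real.pi : ℂ) ^ Fintype.card ι * ∏ i, ((α i).factorial : ℂ) else 0 := by
  rw [integral_fintype_prod_volume_eq_prod]
  simp_rw [integral_gaussMonomial]
  split_ifs with h
  · simp [h, prod_mul_distrib]
  · obtain ⟨i, hi⟩ := DFunLike.ne_iff.1 h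
    exact prod_eq_zero (mem_univ i) (if_neg hi)

/-- Monomials are orthogonal for the Gaussian weight, with squared norms proportional to `α!`. -/
lemma integral_norm_eval_sq_mul_exp {ι : Type*} [Fintype ι] (P : MvPolynomial ι ℂ) :
    ∫ z : ι → ℂ, ((‖eval z P‖ ^ 2 * Real.exp (-∑ i, ‖z i‖ ^ 2) : ℝ) : ℂ) =
      (Real.pi : ℂ) ^ Fintype.card ι * fischer P := by
  have h : ∀ z : ι → ℂ, ((‖eval z P‖ ^ 2 * Real.exp (-∑ i, ‖z i‖ ^ 2) : ℝ) : ℂ) =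
      ∑ α ∈ P.support, ∑ β ∈ P.support, (star (P.coeff α) * P.coeff β) *
        ∏ i, gaussMonomial (α i) (β i) (z i) := by
    intro z
    simp only [gaussMonomial, prod_mul_distrib]
    rw [← sum_neg_distrib, Real.exp_sum, eval_eq', Complex.ofReal_mul, Complex.ofReal_pow,
      ← Complex.conj_mul', map_sum, sum_mul_sum, sum_mul, Complex.ofReal_prod]
    refine sum_congr rfl fun α _ => ?_
    rw [sum_mul]
    refine sum_congr rfl fun β _ => ?_
    simp only [map_mul, map_prod, map_pow, Complex.star_def]
    ring
  have hint : ∀ α β : ι →₀ ℕ, Integrable fun z : ι → ℂ => ∏ i, gaussMonomial (α i) (β i) (z i) :=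
    fun α β => Integrable.fintype_prod fun i => integrable_gaussMonomial _ _
  simp_rw [h]
  rw [integral_finsetSum _ fun α _ => integrable_finsetSum _ fun β _ => (hint α β).const_mul _,
    fischer, Complex.ofReal_sum, mul_sum]
  refine sum_congr rfl fun α hα => ?_
  rw [integral_finsetSum _ fun β _ => (hint α β).const_mul _]
  simp_rw [integral_const_mul, integral_prod_gaussMonomial]
  rw [sum_eq_single_of_mem α hα]
  · rw [if_pos rfl, Complex.star_def, Complex.conj_mul']
    push_cast
    ring
  · intro β _ hne
    rw [if_neg hne.symm, mul_zero]

lemma eval_smul_of_isHomogeneous {ι : Type*} [Fintype ι] {P : MvPolynomial ι ℂ} {d : ℕ}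
    (hP : P.IsHomogeneous d) (r : ℂ) (z : ι → ℂ) : eval (r • z) P = r ^ d * eval z P := by
  rw [eval_eq', eval_eq', mul_sum]
  refine sum_congr rfl fun α hα => ?_
  simp only [Pi.smul_apply, smul_eq_mul, mul_pow, prod_mul_distrib]
  rw [prod_pow_eq_pow_sum, sum_eq_of_mem_support hP hα]
  ring

/-- The point is that `c` depends on neither `d` nor `P`. The factorial is `Γ (2 ^ n + d)`: the real
dimension is `2 * 2 ^ n` and the squared modulus has degree `2 * d`. -/
lemma exists_integral_toSphere (n : ℕ) : ∃ c : ℝ, ∀ (d : ℕ) (P : MvPolynomial (Bits n) ℂ),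
    P.IsHomogeneous d → (∫ ψ, ‖eval (fun x => ψ.1 x) P‖ ^ 2
      ∂(volume : Measure (QubitSpace n)).toSphere) * (2 ^ n + d - 1).factorial = c * fischer P := by
  obtain ⟨c, hc⟩ := exists_integral_comp_ofLp (Bits n)
  refine ⟨2 * (c * Real.pi ^ Fintype.card (Bits n)), fun d P hP => ?_⟩
  have hhom : ∀ r : ℝ, 0 < r → ∀ x : QubitSpace n, ‖eval (fun i => (r • x) i) P‖ ^ 2 =
      r ^ (2 * d) * ‖eval (fun i => x i) P‖ ^ 2 := by
    intro r hr x
    have : (fun i => (r • x) i) = (r : ℂ) • fun i => x i := by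
      ext i
      simp
    rw [this, eval_smul_of_isHomogeneous hP, norm_mul, norm_pow, Complex.norm_real,
      Real.norm_of_nonneg hr.le]
    ring
  have h1 := integral_homogeneous_mul_exp (volume : Measure (QubitSpace n))
    (f := fun z => ‖eval (fun i => z i) P‖ ^ 2) hhom
  have h2 := hc fun z => ((‖eval z P‖ ^ 2 * Real.exp (-∑ i, ‖z i‖ ^ 2) : ℝ) : ℂ)
  rw [integral_norm_eval_sq_mul_exp, integral_complex_ofReal] at h2
  simp_rw [EuclideanSpace.norm_sq_eq] at h1
  have hdim : Module.finrank ℝ (QubitSpace n) = 2 * 2 ^ n := by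
    rw [← Module.finrank_mul_finrank ℝ ℂ, Complex.finrank_real_complex, finrank_euclideanSpace]
    simp
  have hG : ((2 * d + Module.finrank ℝ (QubitSpace n) : ℕ) : ℝ) / 2 = (2 ^ n + d - 1 : ℕ) + 1 := by
    have : 0 < 2 ^ n := by positivity
    rw [hdim, ← Nat.cast_succ, Nat.succ_eq_add_one, Nat.sub_add_cancel (by omega)]
    push_cast
    ring
  rw [hG, Real.Gamma_nat_eq_factorial] at h1
  have h3 : ∫ z : QubitSpace n, ‖eval (fun x => z x) P‖ ^ 2 * Real.exp (-∑ i, ‖z i‖ ^ 2) =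
      c * (Real.pi ^ Fintype.card (Bits n) * fischer P) := by
    exact_mod_cast h2
  rw [h3] at h1
  linarith

/-- The second moment of a homogeneous polynomial under the Haar distribution. -/
theorem integral_haarState_mul_ascFactorial {n d : ℕ} {P : MvPolynomial (Bits n) ℂ}
    (hP : P.IsHomogeneous d) :
    (∫ ψ, ‖eval (fun x => ψ.1 x) P‖ ^ 2 ∂haarState n) * ((2 ^ n).ascFactorial d : ℕ) =
      fischer P := by
  obtain ⟨c, hc⟩ := exists_integral_toSphere n
  have hpos : 0 < 2 ^ n := by positivity
  have h1 := hc d P hP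
  -- The constant polynomial expresses `c` through the total mass of the sphere.
  have h0 := hc 0 1 (isHomogeneous_one _ _)
  set V := (volume : Measure (QubitSpace n)).toSphere.real Set.univ with hV
  have hV1 : V⁻¹ * V = 1 := by
    have := probReal_univ (μ := haarState n)
    rwa [haarState, measureReal_ennreal_smul_apply, ENNReal.toReal_inv] at this
  simp only [map_one, norm_one, one_pow] at h0
  rw [integral_const, smul_eq_mul, mul_one, ← hV, fischer_one,
    mul_one, add_zero] at h0
  have hf : ((2 ^ n + d - 1).factorial : ℝ) =
      (2 ^ n - 1).factorial * ((2 ^ n).ascFactorial d : ℕ) := by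
    have := Nat.factorial_mul_ascFactorial (2 ^ n - 1) d
    rw [Nat.sub_add_cancel hpos, show 2 ^ n - 1 + d = 2 ^ n + d - 1 by omega] at this
    exact_mod_cast this.symm
  rw [haarState, integral_smul_measure, ENNReal.toReal_inv, ← Measure.real, ← hV, smul_eq_mul]
  rw [← h0, hf] at h1
  have hfac : ((2 ^ n - 1).factorial : ℝ) ≠ 0 := by positivity
  have : (∫ ψ, ‖eval (fun x => ψ.1 x) P‖ ^ 2 ∂(volume : Measure (QubitSpace n)).toSphere) *
      ((2 ^ n).ascFactorial d : ℕ) = V * fischer P := by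
    refine mul_left_cancel₀ hfac ?_
    linarith
  rw [mul_assoc, this, ← mul_assoc, hV1, one_mul]

end HaarLOCC

/-! ### Local operations on Haar states -/

namespace HaarLOCC

open Finset MvPolynomial Matrix

/-! ### Tensor products of local operators -/

section Tensor

variable {ι : Type} [Fintype ι] {R S T : ι → Type}

lemma tensor_mul [DecidableEq ι] [∀ i, Fintype (S i)] (K : ∀ i, Matrix (T i) (S i) ℂ)
    (L : ∀ i, Matrix (S i) (R i) ℂ) : tensor K * tensor L = tensor fun i => K i * L i := by
  ext a b
  simp only [tensor, Matrix.mul_apply, Matrix.of_apply, ← prod_mul_distrib]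
  exact (Fintype.prod_sum fun i c => K i (a i) c * L i c (b i)).symm

lemma conjTranspose_tensor (K : ∀ i, Matrix (S i) (R i) ℂ) :
    (tensor K)ᴴ = tensor fun i => (K i)ᴴ := by
  ext a b
  simp [tensor, Matrix.conjTranspose_apply]

lemma tensor_one [∀ i, DecidableEq (R i)] :
    tensor (fun i => (1 : Matrix (R i) (R i) ℂ)) = 1 := by
  ext a b
  simp only [tensor, Matrix.of_apply, Matrix.one_apply]
  split_ifs with h
  · simp [h]
  · obtain ⟨i, hi⟩ := Function.ne_iff.1 h
    exact prod_eq_zero (mem_univ i) (if_neg hi)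

lemma sum_tensor [DecidableEq ι] {κ : ι → Type} [∀ i, Fintype (κ i)]
    (K : ∀ i, κ i → Matrix (S i) (R i) ℂ) :
    ∑ k : ∀ i, κ i, tensor (fun i => K i (k i)) = tensor fun i => ∑ k, K i k := by
  ext a b
  simp only [tensor, Matrix.sum_apply, Matrix.of_apply]
  exact (Fintype.prod_sum fun i c => K i c (a i) (b i)).symm

end Tensor

/-! ### Linearity, trace preservation and comparison for protocols -/

section Protocol

variable {m : ℕ}

lemma postState_sum {R S Ω : Fin m → Type}
    [∀ i, Fintype (R i)] [∀ i, DecidableEq (R i)] [∀ i, Fintype (S i)] [∀ i, Fintype (Ω i)]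
    (I : ∀ i, Instrument (R i) (S i) (Ω i)) (w : ∀ i, Ω i) {κ : Type*} (s : Finset κ)
    (ρ : κ → Matrix (∀ i, R i) (∀ i, R i) ℂ) :
    postState I w (∑ k ∈ s, ρ k) = ∑ k ∈ s, postState I w (ρ k) := by
  simp only [postState, Matrix.mul_sum, Matrix.sum_mul]
  exact sum_comm

lemma sum_trace_postState {R S Ω : Fin m → Type}
    [∀ i, Fintype (R i)] [∀ i, DecidableEq (R i)] [∀ i, Fintype (S i)] [∀ i, Fintype (Ω i)]
    (I : ∀ i, Instrument (R i) (S i) (Ω i)) (ρ : Matrix (∀ i, R i) (∀ i, R i) ℂ) :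
    ∑ w, (postState I w ρ).trace = ρ.trace := by
  have h : ∑ w : ∀ i, Ω i, ∑ k : ∀ i, Fin (I i).rank,
      (tensor fun i => (I i).K (w i) (k i))ᴴ * (tensor fun i => (I i).K (w i) (k i)) = 1 := by
    simp_rw [conjTranspose_tensor, tensor_mul]
    rw [sum_congr rfl fun w _ => sum_tensor fun i k => ((I i).K (w i) k)ᴴ * (I i).K (w i) k,
      sum_tensor fun i w => ∑ k, ((I i).K w k)ᴴ * (I i).K w k]
    simp_rw [(I _).complete]
    exact tensor_one
  simp only [postState, Matrix.trace_sum]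
  conv_rhs => rw [← Matrix.one_mul ρ, ← h, Matrix.sum_mul, Matrix.trace_sum]
  refine sum_congr rfl fun w _ => ?_
  rw [Matrix.sum_mul, Matrix.trace_sum]
  exact sum_congr rfl fun k _ => by rw [Matrix.trace_mul_comm, Matrix.mul_assoc]

lemma Protocol.prob_sum {R : Fin m → Type} [∀ i, Fintype (R i)] [∀ i, DecidableEq (R i)]
    (P : Protocol m R) {κ : Type*} (s : Finset κ) (ρ : κ → Matrix (∀ i, R i) (∀ i, R i) ℂ) :
    P.prob (∑ k ∈ s, ρ k) = ∑ k ∈ s, P.prob (ρ k) := by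
  induction P with
  | output b =>
    simp only [Protocol.prob]
    split_ifs <;> simp [Matrix.trace_sum]
  | round S Ω I next ih =>
    simp only [Protocol.prob, postState_sum, ih]
    exact sum_comm

/-- A lower bound on the diagonal after every product operation passes to the probabilities of
both outputs of an LOCC adversary. -/
lemma Protocol.mul_prob_le {Q : Fin m → Type} [∀ i, Fintype (Q i)]
    {ρ τ : Matrix (∀ i, Q i) (∀ i, Q i) ℂ} {r : ℝ}
    (h : ∀ {R : Fin m → Type} [∀ i, Fintype (R i)] (L : ∀ i, Matrix (R i) (Q i) ℂ) (s : ∀ i, R i),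
      r * ((tensor L * τ * (tensor L)ᴴ) s s).re ≤ ((tensor L * ρ * (tensor L)ᴴ) s s).re)
    {R : Fin m → Type} [∀ i, Fintype (R i)] [∀ i, DecidableEq (R i)] (P : Protocol m R)
    (L : ∀ i, Matrix (R i) (Q i) ℂ) :
    r * P.prob (tensor L * τ * (tensor L)ᴴ) ≤ P.prob (tensor L * ρ * (tensor L)ᴴ) ∧
    r * ((tensor L * τ * (tensor L)ᴴ).trace.re - P.prob (tensor L * τ * (tensor L)ᴴ)) ≤
      (tensor L * ρ * (tensor L)ᴴ).trace.re - P.prob (tensor L * ρ * (tensor L)ᴴ) := by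
  induction P with
  | output b =>
    have ht : r * (tensor L * τ * (tensor L)ᴴ).trace.re ≤ (tensor L * ρ * (tensor L)ᴴ).trace.re := by
      simp only [Matrix.trace, Matrix.diag, Complex.re_sum, mul_sum]
      exact sum_le_sum fun s _ => h L s
    cases b <;> simpa [Protocol.prob] using ht
  | @round R _ _ S _ _ Ω _ I next ih =>
    -- Each Kraus operator of the round is absorbed into `L`, so the induction hypothesis applies to
    -- the same initial states with a new product operator.
    have hpost : ∀ (χ : Matrix (∀ i, Q i) (∀ i, Q i) ℂ) (w : ∀ i, Ω i),
        postState I w (tensor L * χ * (tensor L)ᴴ) = ∑ k : ∀ i, Fin (I i).rank,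
          tensor (fun i => (I i).K (w i) (k i) * L i) * χ *
            (tensor (fun i => (I i).K (w i) (k i) * L i))ᴴ := by
      intro χ w
      simp only [postState, ← tensor_mul, Matrix.conjTranspose_mul, Matrix.mul_assoc]
    rw [← sum_trace_postState I (tensor L * τ * (tensor L)ᴴ),
      ← sum_trace_postState I (tensor L * ρ * (tensor L)ᴴ)]
    simp only [Protocol.prob, Complex.re_sum, ← sum_sub_distrib, mul_sum]
    refine ⟨sum_le_sum fun w _ => ?_, sum_le_sum fun w _ => ?_⟩ <;>
      simp only [hpost, Protocol.prob_sum, Matrix.trace_sum, Complex.re_sum, ← sum_sub_distrib,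
        mul_sum]
    · exact sum_le_sum fun k _ => (ih w _).1
    · exact sum_le_sum fun k _ => (ih w _).2

end Protocol

/-! ### Diagonal entries as moments of polynomials -/

lemma mul_integral_mul_conjTranspose {Ω R S : Type*} [Fintype R] [MeasurableSpace Ω]
    (μ : Measure Ω) (v : Ω → R → ℂ) (hv : ∀ a b, Integrable (fun ω => v ω a * star (v ω b)) μ)
    (A : Matrix S R ℂ) (s : S) :
    (A * (Matrix.of fun a b => ∫ ω, v ω a * star (v ω b) ∂μ) * Aᴴ) s s =
      ((∫ ω, ‖(A *ᵥ v ω) s‖ ^ 2 ∂μ : ℝ) : ℂ) := by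
  simp only [Matrix.mul_apply, Matrix.of_apply, Matrix.conjTranspose_apply, sum_mul]
  rw [← integral_complex_ofReal]
  have h : ∀ ω, ((‖(A *ᵥ v ω) s‖ ^ 2 : ℝ) : ℂ) =
      ∑ b, ∑ a, A s a * star (A s b) * (v ω a * star (v ω b)) := by
    intro ω
    rw [Complex.ofReal_pow, ← Complex.mul_conj', Matrix.mulVec, dotProduct, map_sum, sum_mul_sum,
      sum_comm]
    refine sum_congr rfl fun b _ => sum_congr rfl fun a _ => ?_
    simp only [map_mul, Complex.star_def]
    ring
  simp_rw [h]
  rw [integral_finsetSum _ fun b _ => integrable_finsetSum _ fun a _ => (hv a b).const_mul _]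
  refine sum_congr rfl fun b _ => ?_
  rw [integral_finsetSum _ fun a _ => (hv a b).const_mul _]
  refine sum_congr rfl fun a _ => ?_
  rw [integral_const_mul]
  ring

/-- The amplitudes of `|v⟩^{⊗ t}`. -/
noncomputable def copyVec (t : ℕ) {n : ℕ} (v : QubitSpace n) (a : Fin t → Bits n) : ℂ :=
  ∏ j, v (a j)

lemma copies_apply (t : ℕ) {n : ℕ} (v : QubitSpace n) (a b : Fin t → Bits n) :
    copies t v a b = copyVec t v a * star (copyVec t v b) := by
  simp [copies, tensor, ketbra, copyVec, Matrix.vecMulVec_apply, prod_mul_distrib]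

lemma continuous_copyVec (t n : ℕ) (a : Fin t → Bits n) :
    Continuous fun ψ : Metric.sphere (0 : QubitSpace n) 1 => copyVec t ψ.1 a := by
  unfold copyVec
  fun_prop

lemma sum_norm_copyVec_sq {t n : ℕ} (ψ : Metric.sphere (0 : QubitSpace n) 1) :
    ∑ a, ‖copyVec t ψ.1 a‖ ^ 2 = 1 := by
  have h : ∑ x, ‖ψ.1 x‖ ^ 2 = 1 := by
    rw [← EuclideanSpace.norm_sq_eq, norm_eq_of_mem_sphere, one_pow]
  simp only [copyVec, norm_prod, ← prod_pow]
  rw [← Fintype.prod_sum fun (_ : Fin t) x => ‖ψ.1 x‖ ^ 2]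
  simp [h]

lemma _root_.Continuous.integrable_haarState {n : ℕ} {E : Type*} [NormedAddCommGroup E]
    {f : Metric.sphere (0 : QubitSpace n) 1 → E} (hf : Continuous f) :
    Integrable f (haarState n) :=
  hf.integrable_of_hasCompactSupport (HasCompactSupport.of_compactSpace f)

lemma haarCopies_eq (n t : ℕ) : haarCopies n t =
    Matrix.of fun a b => ∫ ψ, copyVec t ψ.1 a * star (copyVec t ψ.1 b) ∂haarState n := by
  simp only [haarCopies, copies_apply]

lemma sharedState_eq (m n t : ℕ) : sharedState m n t = Matrix.of fun a b =>
    ∫ ψ, (∏ i, copyVec t ψ.1 (a i)) * star (∏ i, copyVec t ψ.1 (b i)) ∂haarState n := by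
  simp only [sharedState, tensor, copies_apply, Matrix.of_apply, prod_mul_distrib, star_prod]

/-- The polynomial in the amplitudes of `v` that gives the amplitude of `L |v⟩^{⊗ t}` at `s`. -/
noncomputable def amplitudePoly {n t : ℕ} {R : Type} (L : Matrix R (Fin t → Bits n) ℂ) (s : R) :
    MvPolynomial (Bits n) ℂ :=
  ∑ a, C (L s a) * ∏ j, X (a j)

lemma isHomogeneous_amplitudePoly {n t : ℕ} {R : Type} (L : Matrix R (Fin t → Bits n) ℂ) (s : R) :
    (amplitudePoly L s).IsHomogeneous t := by
  refine IsHomogeneous.sum _ _ _ fun a _ => ?_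
  have := (isHomogeneous_C (Bits n) (L s a)).mul
    (IsHomogeneous.prod univ (fun j => X (R := ℂ) (a j)) (fun _ => 1) fun j _ => isHomogeneous_X _ _)
  simpa using this

lemma eval_amplitudePoly {n t : ℕ} {R : Type} (L : Matrix R (Fin t → Bits n) ℂ) (s : R)
    (v : QubitSpace n) : eval (fun x => v x) (amplitudePoly L s) = (L *ᵥ copyVec t v) s := by
  simp [amplitudePoly, copyVec, Matrix.mulVec, dotProduct]

lemma haarCopies_diag {n t : ℕ} {R : Type} (L : Matrix R (Fin t → Bits n) ℂ) (s : R) :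
    (L * haarCopies n t * Lᴴ) s s =
      ((∫ ψ, ‖eval (fun x => ψ.1 x) (amplitudePoly L s)‖ ^ 2 ∂haarState n : ℝ) : ℂ) := by
  rw [haarCopies_eq, mul_integral_mul_conjTranspose]
  · simp_rw [eval_amplitudePoly]
  · intro a b
    exact ((continuous_copyVec t n a).mul (continuous_copyVec t n b).star).integrable_haarState

lemma independentState_diag {m n t : ℕ} {R : Fin m → Type}
    (L : ∀ i, Matrix (R i) (Fin t → Bits n) ℂ) (s : ∀ i, R i) :
    (tensor L * independentState m n t * (tensor L)ᴴ) s s = ((∏ i,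
      ∫ ψ, ‖eval (fun x => ψ.1 x) (amplitudePoly (L i) (s i))‖ ^ 2 ∂haarState n : ℝ) : ℂ) := by
  rw [independentState, conjTranspose_tensor, tensor_mul, tensor_mul, Complex.ofReal_prod]
  simp only [tensor, Matrix.of_apply, haarCopies_diag]

/-- All parties hold the same `ψ`, so the local amplitudes multiply under a single integral. -/
lemma sharedState_diag {m n t : ℕ} {R : Fin m → Type}
    (L : ∀ i, Matrix (R i) (Fin t → Bits n) ℂ) (s : ∀ i, R i) :
    (tensor L * sharedState m n t * (tensor L)ᴴ) s s = ((∫ ψ,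
      ‖eval (fun x => ψ.1 x) (∏ i, amplitudePoly (L i) (s i))‖ ^ 2 ∂haarState n : ℝ) : ℂ) := by
  rw [sharedState_eq, mul_integral_mul_conjTranspose _
    fun (ψ : Metric.sphere (0 : QubitSpace n) 1) (a : ∀ i, PartyReg m n t i) =>
      ∏ i, copyVec t ψ.1 (a i)]
  · simp_rw [map_prod, eval_amplitudePoly, Matrix.mulVec, dotProduct, tensor, Matrix.of_apply,
      ← prod_mul_distrib]
    simp_rw [Fintype.prod_sum]
  · intro a b
    exact ((continuous_finsetProd _ fun i _ => continuous_copyVec t n (a i)).mul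
      (continuous_finsetProd _ fun i _ => continuous_copyVec t n (b i)).star).integrable_haarState

/-- Induction on `k`, one factor `N + k` at a time. The sign of `1 - k ^ 2 / N` plays no role, so no
smallness assumption is needed. -/
lemma one_sub_sq_div_mul_ascFactorial_le {N : ℕ} (hN : 0 < N) (k : ℕ) :
    (1 - (k : ℝ) ^ 2 / N) * (N.ascFactorial k : ℕ) ≤ (N : ℝ) ^ k := by
  have hN' : (0 : ℝ) < N := Nat.cast_pos.2 hN
  induction k with
  | zero => simp
  | succ k ih =>
    have h : (1 - ((k + 1 : ℕ) : ℝ) ^ 2 / N) * (N + k) ≤ N * (1 - (k : ℝ) ^ 2 / N) := by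
      have h1 : (N : ℝ) * (1 - (k : ℝ) ^ 2 / N) = N - k ^ 2 := by field_simp
      have h2 : (1 - ((k + 1 : ℕ) : ℝ) ^ 2 / N) * (N + k) =
          N - k ^ 2 - (k + 1) - (k + 1) ^ 2 * k / N := by
        push_cast; field_simp; ring
      rw [h1, h2]
      have : 0 ≤ ((k : ℝ) + 1) ^ 2 * k / N := by positivity
      have : (0 : ℝ) ≤ k := Nat.cast_nonneg k
      linarith
    rw [Nat.ascFactorial_succ, Nat.cast_mul, Nat.cast_add N k, ← mul_assoc, pow_succ' (N : ℝ) k]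
    calc _ ≤ N * (1 - (k : ℝ) ^ 2 / N) * (N.ascFactorial k : ℕ) :=
          mul_le_mul_of_nonneg_right h (Nat.cast_nonneg _)
      _ ≤ N * (N : ℝ) ^ k := by rw [mul_assoc]; exact mul_le_mul_of_nonneg_left ih hN'.le

/-- Bombieri's inequality, rewritten in Haar moments, leaves the ratio of the `m`-th power of `N (N
+ 1) ⋯ (N + t - 1)` to `N (N + 1) ⋯ (N + m t - 1)`. Bounding the numerator below by `N ^ (m t)`
reduces it to the preceding estimate. -/
lemma mul_independentState_diag_le {m n t : ℕ} {R : Fin m → Type}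
    (L : ∀ i, Matrix (R i) (Fin t → Bits n) ℂ) (s : ∀ i, R i) :
    (1 - (m : ℝ) ^ 2 * (t : ℝ) ^ 2 / 2 ^ n) *
      ((tensor L * independentState m n t * (tensor L)ᴴ) s s).re ≤
      ((tensor L * sharedState m n t * (tensor L)ᴴ) s s).re := by
  rw [independentState_diag, sharedState_diag, Complex.ofReal_re, Complex.ofReal_re]
  have hhom : ∀ i ∈ univ, (amplitudePoly (L i) (s i)).IsHomogeneous t :=
    fun i _ => isHomogeneous_amplitudePoly _ _
  have hB := prod_fischer_le univ hhom
  have hhom' := IsHomogeneous.prod univ _ _ hhom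
  rw [← integral_haarState_mul_ascFactorial hhom',
    prod_congr rfl fun i hi => (integral_haarState_mul_ascFactorial (hhom i hi)).symm,
    prod_mul_distrib] at hB
  simp only [sum_const, prod_const, card_univ, Fintype.card_fin, smul_eq_mul] at hB
  have hN : 0 < 2 ^ n := by positivity
  have hasc := one_sub_sq_div_mul_ascFactorial_le hN (m * t)
  have hpow : ((2 ^ n : ℕ) : ℝ) ^ (m * t) ≤ (((2 ^ n).ascFactorial t : ℕ) : ℝ) ^ m := by
    rw [mul_comm, pow_mul]
    exact pow_le_pow_left₀ (by positivity) (by exact_mod_cast Nat.pow_succ_le_ascFactorial _ _) m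
  have hpos : (0 : ℝ) < ((2 ^ n).ascFactorial (m * t) : ℕ) :=
    Nat.cast_pos.2 ((pow_pos hN _).trans_le (Nat.pow_succ_le_ascFactorial _ _))
  push_cast [mul_pow] at hasc
  refine le_of_mul_le_mul_right ?_ hpos
  have hE : 0 ≤ ∏ i, ∫ ψ, ‖eval (fun x => ψ.1 x) (amplitudePoly (L i) (s i))‖ ^ 2 ∂haarState n :=
    prod_nonneg fun i _ => integral_nonneg fun _ => by positivity
  refine le_trans ?_ hB
  rw [mul_right_comm, mul_comm]
  refine mul_le_mul_of_nonneg_left (hasc.trans ?_) hE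
  exact_mod_cast hpow

/-! ### Normalization of the two states -/

lemma trace_haarCopies (n t : ℕ) : (haarCopies n t).trace = 1 := by
  have h : ∀ a, haarCopies n t a a = ((∫ ψ, ‖copyVec t ψ.1 a‖ ^ 2 ∂haarState n : ℝ) : ℂ) := by
    intro a
    rw [haarCopies_eq, Matrix.of_apply, ← integral_complex_ofReal]
    simp_rw [Complex.star_def, Complex.mul_conj', Complex.ofReal_pow]
  simp only [Matrix.trace, Matrix.diag, h, ← Complex.ofReal_sum]
  rw [← integral_finsetSum]
  · simp [sum_norm_copyVec_sq]
  · exact fun a _ => ((continuous_copyVec t n a).norm.pow 2).integrable_haarState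

lemma trace_independentState (m n t : ℕ) : (independentState m n t).trace = 1 := by
  simp only [Matrix.trace, Matrix.diag, independentState, tensor, Matrix.of_apply]
  rw [← Fintype.prod_sum fun (_ : Fin m) a => haarCopies n t a a]
  exact prod_eq_one fun _ _ => trace_haarCopies n t

lemma trace_sharedState (m n t : ℕ) : (sharedState m n t).trace = 1 := by
  have h : ∀ a, sharedState m n t a a =
      ((∫ ψ, ∏ i, ‖copyVec t ψ.1 (a i)‖ ^ 2 ∂haarState n : ℝ) : ℂ) := by
    intro a
    rw [sharedState_eq, Matrix.of_apply, ← integral_complex_ofReal]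
    simp_rw [Complex.star_def, Complex.mul_conj', norm_prod, prod_pow, Complex.ofReal_pow]
  simp only [Matrix.trace, Matrix.diag, h, ← Complex.ofReal_sum]
  rw [← integral_finsetSum]
  · have h1 : ∀ ψ : Metric.sphere (0 : QubitSpace n) 1,
        ∑ a : ∀ i, PartyReg m n t i, ∏ i, ‖copyVec t ψ.1 (a i)‖ ^ 2 = 1 := fun ψ => by
      rw [← Fintype.prod_sum fun (_ : Fin m) a => ‖copyVec t ψ.1 a‖ ^ 2]
      exact prod_eq_one fun _ _ => sum_norm_copyVec_sq ψ
    simp [h1]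
  · exact fun a _ => (continuous_finsetProd _ fun i _ =>
      (continuous_copyVec t n (a i)).norm.pow 2).integrable_haarState

end HaarLOCC

theorem mainTheorem11 :
    ∃ C : ℝ, 0 < C ∧ ∀ m n t : ℕ,
      HaarLOCC.LOCCIndistinguishable (C * ((m : ℝ) ^ 2 * (t : ℝ) ^ 2 / 2 ^ n))
        (HaarLOCC.sharedState m n t) (HaarLOCC.independentState m n t) := by
  refine ⟨1, one_pos, fun m n t P => ?_⟩
  obtain ⟨h1, h2⟩ := P.mul_prob_le (fun L s => HaarLOCC.mul_independentState_diag_le L s)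
    (fun _ => (1 : Matrix (Fin t → HaarLOCC.Bits n) (Fin t → HaarLOCC.Bits n) ℂ))
  -- With `r = 0` the comparison only says that both outputs have nonnegative probability on the
  -- independent state, so that `P.prob` lies in `[0, 1]` there.
  obtain ⟨h3, h4⟩ := P.mul_prob_le (ρ := HaarLOCC.independentState m n t)
    (τ := HaarLOCC.independentState m n t) (r := 0) (fun L s => by
      rw [zero_mul, HaarLOCC.independentState_diag, Complex.ofReal_re]
      exact Finset.prod_nonneg fun i _ => integral_nonneg fun _ => by positivity)
    (fun _ => (1 : Matrix (Fin t → HaarLOCC.Bits n) (Fin t → HaarLOCC.Bits n) ℂ))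
  rw [HaarLOCC.tensor_one, Matrix.conjTranspose_one, one_mul, mul_one] at h1 h2 h3 h4
  simp only [one_mul, mul_one, HaarLOCC.trace_sharedState, HaarLOCC.trace_independentState,
    Complex.one_re, zero_mul] at h1 h2 h3 h4
  have hε : 0 ≤ (m : ℝ) ^ 2 * (t : ℝ) ^ 2 / 2 ^ n := by positivity
  rw [one_mul, abs_le]
  -- With `p` and `q` the shared and independent probabilities and `ε` the bound, `(1 - ε) * q ≤ p`
  -- and `(1 - ε) * (1 - q) ≤ 1 - p`, where `0 ≤ q ≤ 1`.
  constructor <;> nlinarith
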